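/- **Theorem (Symmetry property).** Let $n,k$ be positive integers and write $[m]=\{1,\dots,m\}$. A composition of $n$ of length $\ell$ is a sequence $(\alpha_1,\dots,\alpha_\ell)$ of positive integers with $\alpha_1+\cdots+\alpha_\ell=n$. For compositions $\gamma^{(1)},\dots,\gamma^{(k)}$ of $n$, where $\gamma^{(t)}=(\gamma^{(t)}_1,\dots,\gamma^{(t)}_{p_t})$ has length $p_t$, let $c(\gamma^{(1)},\dots,\gamma^{(k)})$ be the number of colored factorizations of the cycle $(1,2,\dots,n)$ with color-compositions $(\gamma^{(1)},\dots,\gamma^{(k)})$, that is, the number of tuples $(\pi_1,\dots,\pi_k,\phi_1,\dots,\phi_k)$ such that - $\pi_1,\dots,\pi_k$ are permutations of $[n]$ with $\pi_1\circ\cdots\circ\pi_k=(1,2,\dots,n)$; - for every $t\in[k]$, $\phi_t:[n]\to[p_t]$ is a surjective map with $\phi_t(a)=\phi_t(b)$ whenever $a,b$ lie in the same cycle of $\pi_t$; - $|\phi_t^{-1}(i)|=\gamma^{(t)}_i$ for all $t\in[k]$ and $i\in[p_t]$. If $\gamma^{(1)},\delta^{(1)},\dots,\gamma^{(k)},\delta^{(k)}$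 are compositions of $n$ such that for every $t\in[k]$ the compositions $\gamma^{(t)}$ and $\delta^{(t)}$ have the same length, then $$c(\gamma^{(1)},\dots,\gamma^{(k)})=c(\delta^{(1)},\dots,\delta^{(k)}).$$ -/

import Mathlib

/-- A `(p₁, …, p_k)`-colored factorization of the long cycle `(1, 2, …, n)`.
The set `[n] = {1, …, n}` is modelled by `Fin n` (with `i : Fin n` standing for `i + 1`), so that the
permutation `(1, 2, …, n)` is `finRotate n`; likewise for the colors `[p_t]` and the indices `[k]`.
Multiplication of permutations is composition: `(f * g) x = f (g x)`. -/
structure ColoredFactorization (n k : ℕ) (p : Fin k → ℕ) where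
  /-- the factors `π₁, …, π_k` -/
  perm : Fin k → Equiv.Perm (Fin n)
  /-- the colorings `φ₁, …, φ_k` -/
  color : (t : Fin k) → Fin n → Fin (p t)
  /-- `π₁ ∘ ⋯ ∘ π_k = (1, 2, …, n)` -/
  prod_eq : (List.ofFn perm).prod = finRotate n
  /-- all the colors are used -/
  color_surjective : ∀ t, Function.Surjective (color t)
  /-- the cycles of `π_t` are monochromatic -/
  color_eq_of_sameCycle : ∀ t a b, (perm t).SameCycle a b → color t a = color t b

/-- There are finitely many colored factorizations, so that `Nat.card` does count them. -/
instance ColoredFactorization.instFinite (n k : ℕ) (p : Fin k → ℕ) :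
    Finite (ColoredFactorization n k p) := by
  refine Finite.of_injective
    (fun F : ColoredFactorization n k p => (F.perm, F.color)) ?_
  rintro ⟨a, b, _, _, _⟩ ⟨a', b', _, _, _⟩ h
  simp only [Prod.mk.injEq] at h
  obtain ⟨rfl, rfl⟩ := h
  rfl

/-- `F` has color-compositions `(γ⁽¹⁾, …, γ⁽ᵏ⁾)`: for all `t` and `i`, exactly `γ⁽ᵗ⁾ᵢ` elements of `[n]`
have color `i` under `φ_t`. The number of colors `p_t` is the length of `γ⁽ᵗ⁾`. -/
def ColoredFactorization.HasColorCompositions {n k : ℕ} (γ : Fin k → Composition n)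
    (F : ColoredFactorization n k (fun t => (γ t).length)) : Prop :=
  ∀ (t : Fin k) (i : Fin (γ t).length),
    (Finset.univ.filter fun a : Fin n => F.color t a = i).card = (γ t).blocksFun i

/-- `c(γ⁽¹⁾, …, γ⁽ᵏ⁾)`: the number of colored factorizations of `(1, 2, …, n)` with color-compositions
`(γ⁽¹⁾, …, γ⁽ᵏ⁾)`. -/
noncomputable def numColoredFactorizations {n k : ℕ} (γ : Fin k → Composition n) : ℕ :=
  Nat.card {F : ColoredFactorization n k (fun t => (γ t).length) // F.HasColorCompositions γ}

/-! The count is unchanged when one color-composition is altered at a time by moving one element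
between two colors. Three reductions isolate this move. All full cycles are conjugate and the counts
are conjugation invariant, so the fixed product `finRotate n` may be replaced by a sum over all full
cycles. Being a full cycle is invariant under rotating a product, so all factors but one can be
frozen: it suffices that, for every `σ`, the sum of `coloringCount w π` over `π` with `σ * π` a full
cycle depends only on the number of colors (`fullCycleSum_coloringCount_eq`). Merge two colors `i`,
`j` into a set `U` and fix everything outside `U`. What remains is `twoBlockCount`: choose the
`a`-set `B ⊆ U` of color `j` and a permutation of `U` preserving it. Deleting the points outside `U`
from the full cycle reduces to counting full cycles of `U` sending `B` into `τ B`. There are `|B \ τ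
B| (a-1)! (|U|-a-1)!` of these (`card_isFullCycleOn_mapsTo`), and summing over `B` cancels the
dependence on `a`. -/

open Equiv Finset

/-- `f` is supported on `S` and permutes `S` in a single cycle (a fixed point if `S` is a singleton). -/
def IsFullCycleOn {α : Type*} (f : Perm α) (S : Finset α) : Prop :=
  (∀ x ∉ S, f x = x) ∧ ∀ T ⊆ S, T.Nonempty → (∀ x ∈ T, f x ∈ T) → T = S

noncomputable instance {α : Type*} (f : Perm α) (S : Finset α) : Decidable (IsFullCycleOn f S) :=
  Classical.propDecidable _

theorem IsFullCycleOn.apply_ne {α : Type*} {S : Finset α} {f : Perm α} (hf : IsFullCycleOn f S) {x y : α}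
    (hx : x ∈ S) (hy : y ∈ S) (hxy : y ≠ x) : f x ≠ x := fun h => by
  have := hf.2 {x} (singleton_subset_iff.2 hx) (singleton_nonempty x) (by simp [h])
  rw [← this, mem_singleton] at hy
  exact hxy hy

theorem IsFullCycleOn.apply_mem {α : Type*} {S : Finset α} {f : Perm α} (hf : IsFullCycleOn f S) {x : α}
    (hx : x ∈ S) : f x ∈ S := by
  by_contra h
  exact h (by rwa [f.injective (hf.1 _ h)])

/-! ### Full cycles of a set, and those mapping one subset into another -/

section FullCycles

variable {α : Type*} [DecidableEq α]

/-- Multiplying by `swap x i` inserts the fixed point `x` of `g` just before `i`: the preimage of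
`i` now goes to `x`, and `x` to `i`. Closed sets correspond by inserting or erasing `x`. -/
theorem isFullCycleOn_swap_mul_iff {S : Finset α} {g : Perm α} {x i : α} (hx : x ∈ S)
    (hi : i ∈ S) (hix : i ≠ x) (hg : g x = x) :
    IsFullCycleOn (swap x i * g) S ↔ IsFullCycleOn g (S.erase x) := by
  have hne : ∀ y, y ≠ x → g y ≠ x := fun y hy h => hy (g.injective (h.trans hg.symm))
  have hfx : (swap x i * g) x = i := by simp [hg]
  have hfi : ∀ y, g y = i → (swap x i * g) y = x := fun y hy => by simp [hy]
  have hfy : ∀ y, y ≠ x → g y ≠ i → (swap x i * g) y = g y := fun y hy hyi => by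
    rw [Perm.mul_apply, swap_apply_of_ne_of_ne (hne y hy) hyi]
  constructor
  · rintro ⟨h1, h2⟩
    refine ⟨fun y hy => ?_, fun T hT hTn hTc => ?_⟩
    · by_cases hyx : y = x
      · rw [hyx, hg]
      have hyS : y ∉ S := fun h => hy (mem_erase.2 ⟨hyx, h⟩)
      have := h1 y hyS
      by_cases hyi : g y = i
      · rw [hfi y hyi] at this
        exact absurd this.symm hyx
      · rwa [hfy y hyx hyi] at this
    · have hxT : x ∉ T := fun h => (notMem_erase x S) (hT h)
      by_cases hiT : i ∈ T
      · have := h2 (insert x T) (insert_subset hx (hT.trans (erase_subset _ _)))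
          (insert_nonempty _ _) (by
            intro y hy
            rcases mem_insert.1 hy with rfl | hy
            · rw [hfx]; exact mem_insert_of_mem hiT
            · by_cases hyi : g y = i
              · rw [hfi y hyi]; exact mem_insert_self _ _
              · rw [hfy y (fun h => hxT (h ▸ hy)) hyi]
                exact mem_insert_of_mem (hTc y hy))
        rw [← this, erase_insert hxT]
      · have := h2 T (hT.trans (erase_subset _ _)) hTn (by
          intro y hy
          rw [hfy y (fun h => hxT (h ▸ hy)) (fun h => hiT (h ▸ hTc y hy))]
          exact hTc y hy)
        exact absurd (this ▸ hx) hxT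
  · rintro ⟨h1, h2⟩
    refine ⟨fun y hy => ?_, fun T hT hTn hTc => ?_⟩
    · have hyx : y ≠ x := fun h => hy (h ▸ hx)
      have hyi : y ≠ i := fun h => hy (h ▸ hi)
      have := h1 y (fun h => hy (mem_of_mem_erase h))
      rw [hfy y hyx (by rwa [this]), this]
    · by_cases hxT : x ∈ T
      · have hiT : i ∈ T := by have := hTc x hxT; rwa [hfx] at this
        have := h2 (T.erase x) (erase_subset_erase x hT) ⟨i, mem_erase.2 ⟨hix, hiT⟩⟩ (by
          intro y hy
          obtain ⟨hyx, hyT⟩ := mem_erase.1 hy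
          refine mem_erase.2 ⟨hne y hyx, ?_⟩
          by_cases hyi : g y = i
          · rwa [hyi]
          · rw [← hfy y hyx hyi]; exact hTc y hyT)
        rw [← insert_erase hxT, this, insert_erase hx]
      -- A closed `T` avoiding `x` also avoids `g⁻¹ i`, yet it would have to be all of `S.erase x`,
      -- which contains that point.
      · have hcl : ∀ y ∈ T, g y ≠ i := fun y hy h => hxT (hfi y h ▸ hTc y hy)
        have hT' := h2 T (fun y hy => mem_erase.2 ⟨fun h => hxT (h ▸ hy), hT hy⟩) hTn (by
          intro y hy
          rw [← hfy y (fun h => hxT (h ▸ hy)) (hcl y hy)]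
          exact hTc y hy)
        have hi' : i ∈ S.erase x := mem_erase.2 ⟨hix, hi⟩
        refine absurd (g.apply_symm_apply i) (hcl _ ?_)
        rw [hT']
        by_contra hcon
        have := h1 _ hcon
        rw [g.apply_symm_apply] at this
        exact hcon (this ▸ hi')

variable [Fintype α]

/-- Sorting the full cycles `f` of `S` by the value `f x`, and removing `x` from the cycle. -/
theorem card_filter_isFullCycleOn_eq_sum {S : Finset α} {x : α} (hx : x ∈ S) (hS : S ≠ {x})
    (P : Perm α → Prop) [DecidablePred P] :
    #{f : Perm α | IsFullCycleOn f S ∧ P f} =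
      ∑ i ∈ S.erase x, #{g : Perm α | IsFullCycleOn g (S.erase x) ∧ P (swap x i * g)} := by
  rw [← card_sigma]
  symm
  refine card_bij (fun a _ => swap x a.1 * a.2) ?_ ?_ ?_
  · rintro ⟨i, g⟩ h
    simp only [mem_sigma, mem_filter, mem_univ, true_and, mem_erase] at h
    obtain ⟨⟨hix, hi⟩, hg, hP⟩ := h
    simp only [mem_filter, mem_univ, true_and]
    exact ⟨(isFullCycleOn_swap_mul_iff hx hi hix (hg.1 x (notMem_erase x S))).2 hg, hP⟩
  · rintro ⟨i, g⟩ h ⟨j, k⟩ h' heq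
    simp only [mem_sigma, mem_filter, mem_univ, true_and, mem_erase] at h h'
    have hg := h.2.1.1 x (notMem_erase x S)
    have hk := h'.2.1.1 x (notMem_erase x S)
    have hij : i = j := by
      have := congrArg (fun f : Perm α => f x) heq
      simpa [hg, hk] using this
    subst hij
    have : g = k := mul_left_cancel heq
    rw [this]
  · intro f hf
    simp only [mem_filter, mem_univ, true_and] at hf
    obtain ⟨hf, hP⟩ := hf
    obtain ⟨y, hy, hyx⟩ : ∃ y ∈ S, y ≠ x := by
      by_contra! hcon
      exact hS (eq_singleton_iff_unique_mem.2 ⟨hx, hcon⟩)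
    have hfx := hf.apply_ne hx hy hyx
    have hff : swap x (f x) * (swap x (f x) * f) = f := by
      rw [← mul_assoc, swap_mul_self, one_mul]
    refine ⟨⟨f x, swap x (f x) * f⟩, ?_, hff⟩
    simp only [mem_sigma, mem_filter, mem_univ, true_and, mem_erase]
    refine ⟨⟨hfx, hf.apply_mem hx⟩, ?_, by rwa [hff]⟩
    rw [← isFullCycleOn_swap_mul_iff hx (hf.apply_mem hx) hfx (by simp), hff]
    exact hf

theorem card_isFullCycleOn {S : Finset α} (hS : S.Nonempty) :
    #{f : Perm α | IsFullCycleOn f S} = (#S - 1).factorial := by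
  induction hn : #S generalizing S with
  | zero => simp [hS.ne_empty] at hn
  | succ n ih =>
    obtain ⟨x, hx⟩ := hS
    by_cases h : S = {x}
    · subst h
      have hn0 : n = 0 := by simpa using hn.symm
      subst hn0
      have : ({f : Perm α | IsFullCycleOn f {x}} : Finset (Perm α)) = {1} := by
        ext f
        simp only [mem_filter, mem_univ, true_and, mem_singleton]
        constructor
        · intro hf
          ext y
          by_cases hy : y = x
          · have := hf.apply_mem (mem_singleton_self x)
            rw [hy, mem_singleton.1 this, Perm.one_apply]
          · rw [hf.1 y (by simpa using hy), Perm.one_apply]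
        · rintro rfl
          refine ⟨fun _ _ => rfl, fun T hT hTn _ => ?_⟩
          rcases subset_singleton_iff.1 hT with h | h
          · exact absurd h hTn.ne_empty
          · exact h
      rw [this]; rfl
    · have := card_filter_isFullCycleOn_eq_sum hx h (fun _ => True)
      simp only [and_true] at this
      have hc : #(S.erase x) = n := by rw [card_erase_of_mem hx, hn]; rfl
      have hne : (S.erase x).Nonempty := by
        rw [nonempty_iff_ne_empty]
        intro h0
        rcases erase_eq_empty_iff S x |>.1 h0 with h1 | h1
        · simp [h1] at hx
        · exact h h1
      rw [this, sum_const, ih hne hc, hc, smul_eq_mul]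
      have : 0 < n := hc ▸ hne.card_pos
      exact Nat.mul_factorial_pred this.ne'

/-- Induction on `#B`: delete a point `x ∈ B \ C` from the cycle and sum over its image `i ∈ C`.
Since `x ∉ C`, no point of `B` may precede `x`, so the shorter cycle must send `B.erase x` into
`C.erase i`. If `B = C`, a full cycle would preserve a proper nonempty subset, so the count is zero.
-/
theorem card_isFullCycleOn_mapsTo {S B C : Finset α} (hB : B ⊆ S) (hC : C ⊆ S) (hBC : #B = #C)
    (hB0 : 0 < #B) (hBS : #B < #S) :
    #{f : Perm α | IsFullCycleOn f S ∧ ∀ y ∈ B, f y ∈ C} =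
      #(B \ C) * ((#B - 1).factorial * (#S - #B - 1).factorial) := by
  induction hn : #B generalizing S B C with
  | zero => omega
  | succ n ih =>
  rcases (B \ C).eq_empty_or_nonempty with h0 | ⟨x, hxBC⟩
  · have hBC' : B = C := eq_of_subset_of_card_le (sdiff_eq_empty_iff_subset.1 h0) hBC.ge
    subst hBC'
    rw [h0, card_empty, zero_mul, card_eq_zero, filter_eq_empty_iff]
    rintro f - ⟨hf, hcl⟩
    exact hBS.ne (congrArg card (hf.2 B hB (card_pos.1 hB0) hcl))
  obtain ⟨hxB, hxC⟩ := mem_sdiff.1 hxBC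
  have hxS := hB hxB
  have hS1 : S ≠ {x} := by rintro rfl; rw [card_singleton] at hBS; omega
  rw [card_filter_isFullCycleOn_eq_sum hxS hS1]
  have hCe : C ⊆ S.erase x := fun y hy => mem_erase.2 ⟨fun h => hxC (h ▸ hy), hC hy⟩
  have key : ∀ i ∈ S.erase x,
      #{g : Perm α | IsFullCycleOn g (S.erase x) ∧ ∀ y ∈ B, (swap x i * g) y ∈ C} =
      if i ∈ C then
        #{g : Perm α | IsFullCycleOn g (S.erase x) ∧ ∀ y ∈ B.erase x, g y ∈ C.erase i} else 0 := by
    intro i hi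
    have hix := (mem_erase.1 hi).1
    split_ifs with hiC
    · congr 1
      ext g
      simp only [mem_filter, mem_univ, true_and]
      refine and_congr_right fun hg => ?_
      have hgx := hg.1 x (notMem_erase x S)
      constructor
      · intro h y hy
        obtain ⟨hyx, hyB⟩ := mem_erase.1 hy
        have h1 := h y hyB
        rw [Perm.mul_apply] at h1
        have hgi : g y ≠ i := by
          intro hgi
          rw [hgi, swap_apply_right] at h1
          exact hxC h1
        rw [swap_apply_of_ne_of_ne (fun h => hyx (g.injective (h.trans hgx.symm))) hgi] at h1
        exact mem_erase.2 ⟨hgi, h1⟩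
      · intro h y hyB
        by_cases hyx : y = x
        · subst hyx
          rwa [Perm.mul_apply, hgx, swap_apply_left]
        · obtain ⟨h1, h2⟩ := mem_erase.1 (h y (mem_erase.2 ⟨hyx, hyB⟩))
          rwa [Perm.mul_apply,
            swap_apply_of_ne_of_ne (fun h => hyx (g.injective (h.trans hgx.symm))) h1]
    · rw [card_eq_zero, filter_eq_empty_iff]
      rintro g - ⟨hg, h⟩
      have := h x hxB
      rw [Perm.mul_apply, hg.1 x (notMem_erase x S), swap_apply_left] at this
      exact hiC this
  rw [sum_congr rfl key, ← sum_filter, filter_mem_eq_inter, inter_eq_right.2 hCe]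
  have hBe : #(B.erase x) = n := by rw [card_erase_of_mem hxB, hn]; rfl
  have hSe : #(S.erase x) = #S - 1 := card_erase_of_mem hxS
  -- For `#B = 1` no constraint survives the deletion, and the induction hypothesis does not cover
  -- the empty set.
  rcases Nat.eq_zero_or_pos n with rfl | hpos
  · have hB1 : B.erase x = ∅ := card_eq_zero.1 hBe
    have hBx : B \ C = {x} := by
      ext y
      simp only [mem_sdiff, mem_singleton]
      constructor
      · rintro ⟨hy, -⟩
        by_contra hyx
        have : y ∈ B.erase x := mem_erase.2 ⟨hyx, hy⟩
        simp [hB1] at this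
      · rintro rfl; exact ⟨hxB, hxC⟩
    have hne : (S.erase x).Nonempty := card_pos.1 (by omega)
    simp only [hB1, notMem_empty, false_imp_iff, implies_true, and_true]
    rw [sum_const, card_isFullCycleOn hne, hBx, ← hBC, hn, hSe]
    simp
  · have hCi : ∀ i ∈ C,
        #{g : Perm α | IsFullCycleOn g (S.erase x) ∧ ∀ y ∈ B.erase x, g y ∈ C.erase i} =
        (#((B \ C).erase x) + if i ∈ B then 1 else 0) *
          ((n - 1).factorial * (#S - (n + 1) - 1).factorial) := by
      intro i hi
      have hix : i ≠ x := fun h => hxC (h ▸ hi)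
      rw [ih (S := S.erase x) (B := B.erase x) (C := C.erase i) (erase_subset_erase x hB)
        ((erase_subset _ _).trans hCe) (by rw [hBe, card_erase_of_mem hi]; omega) (by omega)
        (by omega) hBe, hSe]
      congr 1
      · split_ifs with hiB
        · rw [← card_insert_of_notMem (a := i) (by simp [hi])]
          congr 1
          ext y
          simp only [mem_sdiff, mem_erase, mem_insert]
          by_cases hyi : y = i
          · subst hyi; simp [hiB, hix]
          · simp [hyi]; tauto
        · congr 1
          ext y
          simp only [mem_sdiff, mem_erase]
          by_cases hyi : y = i
          · subst hyi; simp [hiB]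
          · simp [hyi]; tauto
      · congr 2; omega
    rw [sum_congr rfl hCi, ← sum_mul, sum_add_distrib, sum_const, ← card_filter,
      filter_mem_eq_inter, card_erase_of_mem hxBC, smul_eq_mul]
    -- With `#(B \ C) = d + 1`, the sum over `i ∈ C` of `d + [i ∈ B]` is `(n + 1) d + (n - d) = n (d
    -- + 1)`; the factor `n` turns `(n - 1)!` into `n!`.
    have h1 : #(C ∩ B) + #(B \ C) = n + 1 := by
      rw [inter_comm, card_inter_add_card_sdiff, hn]
    have h2 : 0 < #(B \ C) := card_pos.2 ⟨x, hxBC⟩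
    obtain ⟨d, hd⟩ : ∃ d, #(B \ C) = d + 1 := ⟨_, (Nat.succ_pred_eq_of_pos h2).symm⟩
    have h3 : #C = n + 1 := by omega
    rw [hd] at h1 ⊢
    have h4 : #(C ∩ B) = n - d := by omega
    rw [h4, h3, Nat.add_sub_cancel, Nat.add_sub_cancel, ← Nat.mul_factorial_pred hpos.ne']
    obtain ⟨e, rfl⟩ : ∃ e, n = d + e := ⟨n - d, by omega⟩
    rw [Nat.add_sub_cancel_left]
    ring

end FullCycles

/-! ### Independence of the block size when a set is split in two -/

section TwoBlocks

variable {α : Type*} [DecidableEq α]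

theorem card_filter_powersetCard_mem_notMem {U : Finset α} {x y : α} (hx : x ∈ U) (hy : y ∈ U)
    (hxy : x ≠ y) (a : ℕ) :
    #{B ∈ powersetCard (a + 1) U | x ∈ B ∧ y ∉ B} = (#U - 2).choose a := by
  have hc : #((U.erase x).erase y) = #U - 2 := by
    rw [card_erase_of_mem (mem_erase.2 ⟨hxy.symm, hy⟩), card_erase_of_mem hx]; rfl
  rw [← hc, ← card_powersetCard]
  symm
  have hxB : ∀ B ∈ powersetCard a ((U.erase x).erase y), x ∉ B ∧ y ∉ B := fun B hB =>
    ⟨fun h => by simpa using (mem_powersetCard.1 hB).1 h,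
      fun h => by simpa using (mem_powersetCard.1 hB).1 h⟩
  refine card_bij (fun B _ => insert x B) ?_ ?_ ?_
  · intro B hB
    obtain ⟨h1, h2⟩ := hxB B hB
    obtain ⟨h3, h4⟩ := mem_powersetCard.1 hB
    rw [mem_filter, mem_powersetCard, card_insert_of_notMem h1, h4, mem_insert, mem_insert]
    refine ⟨⟨insert_subset hx fun z hz => mem_of_mem_erase (mem_of_mem_erase (h3 hz)), rfl⟩,
      Or.inl rfl, ?_⟩
    rintro (h | h)
    exacts [hxy h.symm, h2 h]
  · intro B hB B' hB' h
    rw [← erase_insert (hxB B hB).1, ← erase_insert (hxB B' hB').1, h]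
  · intro B hB
    obtain ⟨hB, h1, h2⟩ := mem_filter.1 hB
    obtain ⟨h3, h4⟩ := mem_powersetCard.1 hB
    refine ⟨B.erase x, mem_powersetCard.2 ⟨fun z hz => ?_, ?_⟩, insert_erase h1⟩
    · obtain ⟨hzx, hz⟩ := mem_erase.1 hz
      exact mem_erase.2 ⟨fun h => h2 (h ▸ hz), mem_erase.2 ⟨hzx, h3 hz⟩⟩
    · rw [card_erase_of_mem h1, h4]; rfl

/-- Double counting: `x` contributes to the sets `B` containing `x` but not `τ.symm x`. Fixed points
of `τ` contribute nothing; every other point of `U` contributes equally. -/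
theorem sum_card_sdiff_map {U : Finset α} {τ : Perm α} (hτ : ∀ x ∉ U, τ x = x) (a : ℕ) :
    ∑ B ∈ powersetCard (a + 1) U, #(B \ B.map τ.toEmbedding) =
      #{x ∈ U | x ≠ τ.symm x} * (#U - 2).choose a := by
  have h1 : ∀ B ∈ powersetCard (a + 1) U, #(B \ B.map τ.toEmbedding) =
      ∑ x ∈ U, if x ∈ B ∧ τ.symm x ∉ B then 1 else 0 := by
    intro B hB
    rw [← card_filter]
    congr 1
    ext x
    simp only [mem_sdiff, mem_map_equiv, mem_filter]
    exact ⟨fun h => ⟨(mem_powersetCard.1 hB).1 h.1, h⟩, fun h => h.2⟩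
  rw [sum_congr rfl h1, sum_comm, card_filter, sum_mul]
  refine sum_congr rfl fun x hx => ?_
  rw [← card_filter]
  split_ifs with h
  · rw [one_mul]
    refine card_filter_powersetCard_mem_notMem hx ?_ h a
    by_contra hU
    have := hτ _ hU
    rw [apply_symm_apply] at this
    exact h this
  · rw [not_not] at h
    rw [zero_mul, card_eq_zero, filter_eq_empty_iff, ← h]
    exact fun B _ hB => hB.2 hB.1

variable [Fintype α]

/-- The number of pairs `(B, π)` where `B` is an `a`-element subset of `U` and `π` is a permutation
of `U` preserving `B` such that `τ * π` is a full cycle of `S`. -/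
noncomputable def twoBlockCount (τ : Perm α) (S U : Finset α) (a : ℕ) : ℕ :=
  ∑ B ∈ powersetCard a U,
    #{π : Perm α | ((∀ x ∉ U, π x = x) ∧ ∀ x ∈ B, π x ∈ B) ∧ IsFullCycleOn (τ * π) S}

/-- Under `π ↦ τ * π`, preserving `B` becomes mapping `B` into `τ B`. The binomial coefficient from
the sum over `B` absorbs both factorials into `(#U - 2)!`, so `a` disappears. -/
theorem twoBlockCount_self {U : Finset α} {τ : Perm α} (hτ : ∀ x ∉ U, τ x = x) {a : ℕ}
    (ha : 0 < a) (haU : a < #U) :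
    twoBlockCount τ U U a = #{x ∈ U | x ≠ τ.symm x} * (#U - 2).factorial := by
  have h1 : ∀ B ∈ powersetCard a U,
      #{π : Perm α | ((∀ x ∉ U, π x = x) ∧ ∀ x ∈ B, π x ∈ B) ∧ IsFullCycleOn (τ * π) U} =
        #(B \ B.map τ.toEmbedding) * ((a - 1).factorial * (#U - a - 1).factorial) := by
    intro B hB
    obtain ⟨hBU, hBa⟩ := mem_powersetCard.1 hB
    have hτU : ∀ x ∈ U, τ x ∈ U := fun x hx => by
      by_contra h
      exact h (by rwa [τ.injective (hτ _ h)])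
    subst hBa
    rw [← card_isFullCycleOn_mapsTo hBU (fun y hy => ?_) (card_map _).symm ha haU]
    · refine card_equiv (Equiv.mulLeft τ) fun π => ?_
      simp only [mem_filter, mem_univ, true_and, Equiv.coe_mulLeft, mem_map_equiv, Perm.mul_apply,
        symm_apply_apply]
      refine ⟨fun h => ⟨h.2, h.1.2⟩, fun h => ⟨⟨fun x hx => ?_, h.2⟩, h.1⟩⟩
      refine τ.injective ?_
      rw [hτ x hx]
      exact h.1.1 x hx
    · obtain ⟨x, hx, rfl⟩ := mem_map.1 hy
      exact hτU x (hBU hx)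
  obtain ⟨a, rfl⟩ : ∃ b, a = b + 1 := ⟨a - 1, by omega⟩
  rw [twoBlockCount, sum_congr rfl h1, ← sum_mul, sum_card_sdiff_map hτ, mul_assoc,
    Nat.add_sub_cancel, ← Nat.choose_mul_factorial_mul_factorial (n := #U - 2) (k := a) (by omega),
    show #U - (a + 1) - 1 = #U - 2 - a by omega, ← mul_assoc (Nat.choose _ _)]

/-- A point `x ∈ S \ U` is fixed by `π`, so its image in the cycle `τ * π` is always `τ x`. It can
be deleted by changing `τ` alone, until `S = U`. -/
theorem twoBlockCount_eq_of_card_lt {S U : Finset α} (hUS : U ⊆ S) (τ : Perm α) {a b : ℕ}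
    (ha : 0 < a) (haU : a < #U) (hb : 0 < b) (hbU : b < #U) :
    twoBlockCount τ S U a = twoBlockCount τ S U b := by
  induction hn : #S generalizing S τ with
  | zero => have := card_le_card hUS; omega
  | succ n ih =>
  by_cases hτ : ∀ x ∉ S, τ x = x
  swap
  · have h0 : ∀ a, twoBlockCount τ S U a = 0 := by
      intro a
      refine sum_eq_zero fun B _ => ?_
      rw [card_eq_zero, filter_eq_empty_iff]
      rintro π - ⟨⟨h1, -⟩, h2⟩
      refine hτ fun x hx => ?_
      have := h2.1 x hx
      rwa [Perm.mul_apply, h1 x (fun h => hx (hUS h))] at this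
    rw [h0, h0]
  rcases hUS.eq_or_ssubset with rfl | hss
  · rw [twoBlockCount_self hτ ha haU, twoBlockCount_self hτ hb hbU]
  obtain ⟨x, hxS, hxU⟩ := exists_of_ssubset hss
  obtain ⟨y, hy⟩ : U.Nonempty := card_pos.1 (by omega)
  have hyx : y ≠ x := fun h => hxU (h ▸ hy)
  by_cases hfix : τ x = x
  · have h0 : ∀ a, twoBlockCount τ S U a = 0 := by
      intro a
      refine sum_eq_zero fun B _ => ?_
      rw [card_eq_zero, filter_eq_empty_iff]
      rintro π - ⟨⟨h1, -⟩, h2⟩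
      refine h2.apply_ne hxS (hUS hy) hyx ?_
      rw [Perm.mul_apply, h1 x hxU, hfix]
    rw [h0, h0]
  have hτx : τ x ∈ S := by
    by_contra h
    exact hfix (τ.injective (hτ _ h))
  have hred : ∀ a, twoBlockCount τ S U a = twoBlockCount (swap x (τ x) * τ) (S.erase x) U a := by
    intro a
    refine sum_congr rfl fun B _ => ?_
    congr 1
    ext π
    simp only [mem_filter, mem_univ, true_and]
    refine and_congr_right fun h => ?_
    rw [← isFullCycleOn_swap_mul_iff hxS hτx hfix (by simp [h.1 x hxU]), ← mul_assoc, ← mul_assoc,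
      swap_mul_self, one_mul]
  rw [hred, hred]
  exact ih (S := S.erase x) (fun z hz => mem_erase.2 ⟨fun h => hxU (h ▸ hz), hUS hz⟩) _
    (by rw [card_erase_of_mem hxS, hn]; rfl)

end TwoBlocks

/-! ### Merging two colors and moving elements between them -/

section Colorings

variable {α ι : Type*} [DecidableEq α] [Fintype α] [DecidableEq ι] [Fintype ι]

/-- The number of colorings that are constant on the cycles of `π` and use each color `c` exactly
`w c` times. -/
def coloringCount (w : ι → ℕ) (π : Perm α) : ℕ :=
  #{φ : α → ι | (∀ x, φ (π x) = φ x) ∧ ∀ c, #{x | φ x = c} = w c}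

/-- The sum of `f π` over the permutations `π` such that `σ * π` is a full cycle. -/
noncomputable def fullCycleSum (f : Perm α → ℕ) (σ : Perm α) : ℕ :=
  ∑ π : Perm α, if IsFullCycleOn (σ * π) univ then f π else 0

omit [DecidableEq α] [Fintype α] in
theorem apply_mem_iff_of_forall_apply_mem {π : Perm α} {B : Finset α} (h : ∀ x ∈ B, π x ∈ B)
    (x : α) : π x ∈ B ↔ x ∈ B := by
  refine ⟨fun hx => ?_, h x⟩
  have : B.map π.toEmbedding = B :=
    eq_of_subset_of_card_le (fun y hy => by
      obtain ⟨z, hz, rfl⟩ := mem_map.1 hy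
      exact h z hz) (card_map _).ge
  rw [← this] at hx
  simpa using hx

omit [Fintype α] in
theorem exists_perm_eq_on_of_mem_iff {π : Perm α} {U : Finset α} (h : ∀ x, π x ∈ U ↔ x ∈ U) :
    ∃ κ : Perm α, (∀ x ∉ U, κ x = x) ∧ ∀ x ∈ U, κ x = π x :=
  ⟨Perm.ofSubtype (π.subtypePerm h), fun x hx => Perm.ofSubtype_apply_of_not_mem _ hx,
    fun x hx => by rw [Perm.ofSubtype_apply_of_mem _ hx]; rfl⟩

/-- The colorings in which the color `j` has been merged into `i`, together with the permutations
preserving them and fixing the elements of the merged color. -/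
def mergedColorings (w : ι → ℕ) (i j : ι) (m : ℕ) : Finset ((α → ι) × Perm α) :=
  {y | (∀ x, y.1 x ≠ j) ∧ (∀ c, c ≠ i → c ≠ j → #{x | y.1 x = c} = w c) ∧
    #{x | y.1 x = i} = m ∧ (∀ x, y.1 (y.2 x) = y.1 x) ∧ ∀ x, y.1 x = i → y.2 x = x}

/-- A permutation preserving the merged class `U` factors uniquely as `ρ * κ`, with `ρ` fixing `U`
pointwise and `κ` fixing its complement. The original coloring is recovered from the merged one and
the set `B` of color `j`. -/
theorem fullCycleSum_coloringCount_eq_sum (w : ι → ℕ) {i j : ι} (hij : i ≠ j) (σ : Perm α) :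
    fullCycleSum (coloringCount w) σ =
      ∑ y ∈ mergedColorings w i j (w i + w j),
        twoBlockCount (σ * y.2) univ {x | y.1 x = i} (w j) := by
  have h1 : fullCycleSum (coloringCount w) σ =
      #((univ : Finset (Perm α)).sigma fun π => {φ : α → ι | IsFullCycleOn (σ * π) univ ∧
        (∀ x, φ (π x) = φ x) ∧ ∀ c, #{x | φ x = c} = w c}) := by
    rw [card_sigma]
    refine sum_congr rfl fun π _ => ?_
    split_ifs with h
    · simp [h, coloringCount]
    · simp [h]
  simp only [twoBlockCount, ← card_sigma]
  rw [h1]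
  symm
  refine card_bij (fun z _ => ⟨z.1.2 * z.2.2, fun x => if x ∈ z.2.1 then j else z.1.1 x⟩) ?_ ?_ ?_
  · rintro ⟨⟨ψ, ρ⟩, B, π⟩ h
    simp only [mergedColorings, mem_sigma, mem_filter, mem_univ, true_and, mem_powersetCard] at h ⊢
    obtain ⟨⟨hj, hc, hi, hρψ, hρ⟩, ⟨hBU, hBc⟩, ⟨hπU, hπB⟩, hfull⟩ := h
    have hB : ∀ x ∈ B, ψ x = i := fun x hx => (mem_filter.1 (hBU hx)).2
    rw [mul_assoc] at hfull
    refine ⟨hfull, fun x => ?_, fun c => ?_⟩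
    · have hBiff := apply_mem_iff_of_forall_apply_mem hπB
      by_cases hx : ψ x = i
      · have hπx : ψ (π x) = i := by
          by_contra hcon
          have := hπU (π x) (by simpa using hcon)
          rw [π.injective this] at hcon
          exact hcon hx
        rw [Perm.mul_apply, hρ _ hπx, hπx, hx]
        exact if_congr (hBiff x) rfl rfl
      · rw [Perm.mul_apply, hπU x (by simpa using hx), hρψ,
          if_neg (fun h => hx (hρψ x ▸ hB _ h)), if_neg (fun h => hx (hB _ h))]
    · by_cases hcj : c = j
      · subst hcj
        rw [← hBc]
        congr 1
        ext x
        simp only [mem_filter, mem_univ, true_and]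
        split_ifs with h
        · simp [h]
        · simp [h, hj x]
      by_cases hci : c = i
      · subst hci
        have : (univ.filter fun x => (if x ∈ B then j else ψ x) = c) =
            (univ.filter fun x => ψ x = c) \ B := by
          ext x
          simp only [mem_filter, mem_univ, true_and, mem_sdiff]
          split_ifs with h
          · simp [h, hij.symm]
          · simp [h]
        rw [this, card_sdiff_of_subset hBU, hi, hBc, Nat.add_sub_cancel]
      · rw [← hc c hci hcj]
        congr 1
        ext x
        simp only [mem_filter, mem_univ, true_and]
        split_ifs with h
        · simp [hB x h, Ne.symm hci, Ne.symm hcj]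
        · rfl
  · rintro ⟨⟨ψ, ρ⟩, B, π⟩ h ⟨⟨ψ', ρ'⟩, B', π'⟩ h' heq
    simp only [mergedColorings, mem_sigma, mem_filter, mem_univ, true_and, mem_powersetCard] at h h'
    obtain ⟨⟨hj, -, -, hρψ, hρ⟩, ⟨hBU, -⟩, ⟨hπU, -⟩, -⟩ := h
    obtain ⟨⟨hj', -, -, -, hρ'⟩, ⟨hBU', -⟩, ⟨hπU', -⟩, -⟩ := h'
    simp only [Sigma.mk.injEq, heq_eq_eq] at heq
    obtain ⟨hmul, hφ⟩ := heq
    have hBB : B = B' := by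
      ext x
      have := congrFun hφ x
      split_ifs at this with h1 h2 h2
      · simp [h1, h2]
      · exact absurd this.symm (hj' x)
      · exact absurd this (hj x)
      · simp [h1, h2]
    subst hBB
    have hψ : ψ = ψ' := by
      ext x
      by_cases hx : x ∈ B
      · rw [(mem_filter.1 (hBU hx)).2, (mem_filter.1 (hBU' hx)).2]
      · have := congrFun hφ x
        simpa [hx] using this
    subst hψ
    have hρρ : ρ = ρ' := by
      ext x
      by_cases hx : ψ x = i
      · rw [hρ x hx, hρ' x hx]
      · have := congrArg (fun f : Perm α => f x) hmul
        simpa only [Perm.mul_apply, hπU x (by simpa using hx), hπU' x (by simpa using hx)] using this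
    subst hρρ
    rw [mul_left_cancel hmul]
  · rintro ⟨π, φ⟩ h
    simp only [mem_sigma, mem_filter, mem_univ, true_and] at h
    obtain ⟨hfull, hπ, hc⟩ := h
    set ψ : α → ι := fun x => if φ x = j then i else φ x with hψ
    have hψi : ∀ x, ψ x = i ↔ φ x = i ∨ φ x = j := fun x => by
      simp only [hψ]; split_ifs with h <;> simp [h]
    have hψπ : ∀ x, ψ (π x) = ψ x := fun x => by simp only [hψ, hπ]
    obtain ⟨κ, hκ1, hκ2⟩ := exists_perm_eq_on_of_mem_iff (π := π) (U := {x | ψ x = i})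
      (fun x => by simp [hψπ])
    simp only [mem_filter, mem_univ, true_and] at hκ1 hκ2
    have hκψ : ∀ x, ψ (κ x) = ψ x := fun x => by
      by_cases hx : ψ x = i
      · rw [hκ2 x hx, hψπ]
      · rw [hκ1 x hx]
    have hκκ : ∀ x, κ (κ⁻¹ x) = x := κ.apply_symm_apply
    have hκψ' : ∀ x, ψ (κ⁻¹ x) = ψ x := fun x => by rw [← hκψ, hκκ]
    have hfact : π * κ⁻¹ * κ = π := by group
    refine ⟨⟨(ψ, π * κ⁻¹), univ.filter fun x => φ x = j, κ⟩, ?_, ?_⟩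
    · simp only [mergedColorings, mem_sigma, mem_filter, mem_univ, true_and, mem_powersetCard]
      refine ⟨⟨fun x => ?_, fun c hci hcj => ?_, ?_, fun x => ?_, fun x hx => ?_⟩,
        ⟨fun x hx => ?_, hc j⟩, ⟨fun x hx => hκ1 x hx, fun x hx => ?_⟩, ?_⟩
      · simp only [hψ]; split_ifs with h
        exacts [hij, h]
      · rw [← hc c]
        congr 1
        ext x
        simp only [mem_filter, mem_univ, true_and, hψ]
        split_ifs with h
        · simp [h, Ne.symm hci, Ne.symm hcj]
        · rfl
      · rw [← hc i, ← hc j, ← card_union_of_disjoint]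
        · congr 1
          ext x
          simp [hψi]
        · rw [disjoint_filter]
          intro x _ h1 h2
          exact hij (h1.symm.trans h2)
      · rw [Perm.mul_apply, hψπ, hκψ']
      · rw [Perm.mul_apply, ← hκ2 _ ((hκψ' x).trans hx), hκκ]
      · simp only [mem_filter, mem_univ, true_and] at hx ⊢
        exact (hψi x).2 (Or.inr hx)
      · rw [hκ2 x ((hψi x).2 (Or.inr hx)), hπ, hx]
      · rwa [mul_assoc, hfact]
    · simp only [hfact, mem_filter_univ, true_and, Sigma.mk.injEq, heq_eq_eq]
      ext x
      simp only [hψ]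
      split_ifs with h
      exacts [h.symm, rfl]

/-- The merged data see only `w i + w j`; positivity of both sizes keeps the block size strictly
between `0` and that total. -/
theorem fullCycleSum_coloringCount_transfer {w w' : ι → ℕ} {i j : ι} (hij : i ≠ j)
    (hw : ∀ c, 0 < w c) (hw' : ∀ c, 0 < w' c) (hne : ∀ c, c ≠ i → c ≠ j → w c = w' c)
    (hadd : w i + w j = w' i + w' j) (σ : Perm α) :
    fullCycleSum (coloringCount w) σ = fullCycleSum (coloringCount w') σ := by
  rw [fullCycleSum_coloringCount_eq_sum w hij, fullCycleSum_coloringCount_eq_sum w' hij]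
  have hY : mergedColorings (α := α) w i j (w i + w j) =
      mergedColorings w' i j (w' i + w' j) := by
    simp only [mergedColorings, hadd]
    congr 1
    ext y
    refine and_congr_right fun _ => and_congr_left fun _ => ?_
    exact forall_congr' fun c => forall_congr' fun h1 => forall_congr' fun h2 => by
      rw [hne c h1 h2]
  rw [← hY]
  refine sum_congr rfl fun y hy => ?_
  have hcard := (mem_filter.1 hy).2.2.2.1
  have := hw i
  have := hw' i
  exact twoBlockCount_eq_of_card_lt (subset_univ _) _ (hw j) (by omega) (hw' j) (by omega)

/-- Induction on the total excess of `w` over `w'` (truncated subtraction): each step moves one unit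
from an overfull color to an underfull one. -/
theorem fullCycleSum_coloringCount_eq {w w' : ι → ℕ} (hw : ∀ c, 0 < w c) (hw' : ∀ c, 0 < w' c)
    (hsum : ∑ c, w c = ∑ c, w' c) (σ : Perm α) :
    fullCycleSum (coloringCount w) σ = fullCycleSum (coloringCount w') σ := by
  induction hn : ∑ c, (w c - w' c) generalizing w with
  | zero =>
    have hle : ∀ c ∈ univ, w c ≤ w' c := fun c hc =>
      Nat.sub_eq_zero_iff_le.1 (sum_eq_zero_iff.1 hn c hc)
    rw [funext fun c => (sum_eq_sum_iff_of_le hle).1 hsum c (mem_univ c)]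
  | succ n ih =>
    obtain ⟨i, hi⟩ : ∃ i, w' i < w i := by
      by_contra! hcon
      simp [Nat.sub_eq_zero_of_le (hcon _)] at hn
    obtain ⟨j, hj⟩ : ∃ j, w j < w' j := by
      by_contra! hcon
      exact (sum_lt_sum (fun c _ => hcon c) ⟨i, mem_univ i, hi⟩).ne hsum.symm
    have hij : i ≠ j := by rintro rfl; omega
    let v : ι → ℕ := fun c => if c = i then w i - 1 else if c = j then w j + 1 else w c
    have hv : ∀ c, v c = if c = i then w i - 1 else if c = j then w j + 1 else w c := fun _ => rfl
    have hvi : v i = w i - 1 := by simp [hv]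
    have hvj : v j = w j + 1 := by simp [hv, hij.symm]
    have hv0 : ∀ c, c ≠ i → c ≠ j → v c = w c := fun c h1 h2 => by simp [hv, h1, h2]
    -- The decreased size stays positive because `w i > w' i ≥ 1`.
    have hvpos : ∀ c, 0 < v c := fun c => by
      have := hw' i
      have := hw c
      rw [hv]; split_ifs <;> omega
    have h1 : ∑ c, v c + 1 = ∑ c, w c + 1 := by
      have : ∀ c, v c + (if c = i then 1 else 0) = w c + if c = j then 1 else 0 := fun c => by
        rw [hv]
        split_ifs with h1 h2 h2
        · exact absurd (h1.symm.trans h2) hij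
        · subst h1; omega
        · subst h2; rfl
        · rfl
      have h := sum_congr (rfl : (univ : Finset ι) = univ) fun c _ => this c
      simpa [sum_add_distrib] using h
    have h2 : ∑ c, (v c - w' c) + 1 = ∑ c, (w c - w' c) := by
      have : ∀ c, v c - w' c + (if c = i then 1 else 0) = w c - w' c := fun c => by
        rw [hv]
        split_ifs with h1 h2
        · subst h1; omega
        · subst h2; omega
        · rfl
      have h := sum_congr (rfl : (univ : Finset ι) = univ) fun c _ => this c
      simpa [sum_add_distrib] using h
    rw [fullCycleSum_coloringCount_transfer hij hw hvpos (fun c h1 h2 => (hv0 c h1 h2).symm)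
      (by omega)]
    exact ih hvpos (by omega) (by omega)

end Colorings

/-! ### Products of several factors, rotation and conjugation -/

section Products

variable {α : Type*} [DecidableEq α] [Fintype α]

omit [DecidableEq α] in
theorem isFullCycleOn_univ_iff {f : Perm α} :
    IsFullCycleOn f univ ↔ ∀ x y, f.SameCycle x y := by
  classical
  constructor
  · intro h x y
    have := h.2 {y | f.SameCycle x y} (subset_univ _) ⟨x, by simp [Perm.SameCycle.refl]⟩ (by simp)
    have hy := mem_univ y
    rw [← this] at hy
    simpa using hy
  · refine fun h => ⟨fun x hx => absurd (mem_univ x) hx, fun T _ ⟨x, hx⟩ hT => ?_⟩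
    refine eq_univ_of_forall fun y => ?_
    obtain ⟨n, -, rfl⟩ := (h x y).exists_pow_eq'
    induction n with
    | zero => exact hx
    | succ n ih => rw [pow_succ', Perm.mul_apply]; exact hT _ ih

omit [DecidableEq α] in
theorem isFullCycleOn_univ_conj_iff {f : Perm α} (g : Perm α) :
    IsFullCycleOn (g * f * g⁻¹) univ ↔ IsFullCycleOn f univ := by
  simp only [isFullCycleOn_univ_iff, Perm.sameCycle_conj]
  exact ⟨fun h x y => by simpa using h (g x) (g y), fun h x y => h _ _⟩

omit [DecidableEq α] in
theorem isFullCycleOn_univ_mul_comm (f g : Perm α) :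
    IsFullCycleOn (f * g) univ ↔ IsFullCycleOn (g * f) univ := by
  rw [← isFullCycleOn_univ_conj_iff g]
  group

/-- The weights are replaced one factor at a time. The free prefix `σ` absorbs the first factor for
the induction; that factor is then treated by rotating it to the end of the product. -/
theorem sum_isFullCycleOn_prod_congr {k : ℕ} {f f' : Fin k → Perm α → ℕ}
    (h : ∀ t σ, fullCycleSum (f t) σ = fullCycleSum (f' t) σ) (σ : Perm α) :
    ∑ π : Fin k → Perm α,
        (if IsFullCycleOn (σ * (List.ofFn π).prod) univ then ∏ t, f t (π t) else 0) =
      ∑ π : Fin k → Perm α,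
        if IsFullCycleOn (σ * (List.ofFn π).prod) univ then ∏ t, f' t (π t) else 0 := by
  induction k generalizing σ with
  | zero => simp
  | succ k ih =>
    have hsplit : ∀ F : Fin (k + 1) → Perm α → ℕ, ∑ π : Fin (k + 1) → Perm α,
        (if IsFullCycleOn (σ * (List.ofFn π).prod) univ then ∏ t, F t (π t) else 0) =
        ∑ π₀ : Perm α, ∑ π : Fin k → Perm α,
          if IsFullCycleOn (σ * π₀ * (List.ofFn π).prod) univ then
            F 0 π₀ * ∏ t : Fin k, F t.succ (π t) else 0 := by
      intro F
      rw [← (Fin.consEquiv fun _ : Fin (k + 1) => Perm α).sum_comp, Fintype.sum_prod_type]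
      refine sum_congr rfl fun π₀ _ => sum_congr rfl fun π _ => ?_
      simp [Fin.consEquiv, List.ofFn_succ, Fin.prod_univ_succ, mul_assoc]
    rw [hsplit, hsplit]
    calc _ = ∑ π₀ : Perm α, ∑ π : Fin k → Perm α,
          (if IsFullCycleOn (σ * π₀ * (List.ofFn π).prod) univ then
            f 0 π₀ * ∏ t : Fin k, f' t.succ (π t) else 0) := by
          refine sum_congr rfl fun π₀ _ => ?_
          simp only [← mul_ite_zero, ← mul_sum]
          rw [ih fun t => h t.succ]
      _ = _ := by
          rw [sum_comm]
          conv_rhs => rw [sum_comm]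
          refine sum_congr rfl fun π _ => ?_
          simp only [← ite_zero_mul, ← sum_mul, mul_assoc σ]
          have := h 0 ((List.ofFn π).prod * σ)
          simp only [fullCycleSum, mul_assoc, isFullCycleOn_univ_mul_comm (List.ofFn π).prod] at this
          rw [this]

/-- The sum of `∏ t, f t (π t)` over the factorizations of `ζ`. -/
def factorizationSum {k : ℕ} (f : Fin k → Perm α → ℕ) (ζ : Perm α) : ℕ :=
  ∑ π : Fin k → Perm α, if (List.ofFn π).prod = ζ then ∏ t, f t (π t) else 0

theorem factorizationSum_conj {k : ℕ} {f : Fin k → Perm α → ℕ}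
    (hf : ∀ t g π, f t (g * π * g⁻¹) = f t π) (g ζ : Perm α) :
    factorizationSum f (g * ζ * g⁻¹) = factorizationSum f ζ := by
  refine (Fintype.sum_equiv (Equiv.piCongrRight fun _ => (MulAut.conj g).toEquiv) _ _
    fun π => ?_).symm
  have : (List.ofFn fun t => MulAut.conj g (π t)).prod = MulAut.conj g (List.ofFn π).prod := by
    rw [map_list_prod, List.map_ofFn]; rfl
  change _ = if (List.ofFn fun t => MulAut.conj g (π t)).prod = _ then
    ∏ t, f t (MulAut.conj g (π t)) else 0
  rw [this, ← MulAut.conj_apply g ζ]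
  simp only [(MulAut.conj g).injective.eq_iff]
  simp only [MulAut.conj_apply, hf]

theorem sum_isFullCycleOn_prod_eq {k : ℕ} (f : Fin k → Perm α → ℕ) :
    ∑ π : Fin k → Perm α,
        (if IsFullCycleOn (List.ofFn π).prod univ then ∏ t, f t (π t) else 0) =
      ∑ ζ : Perm α with IsFullCycleOn ζ univ, factorizationSum f ζ := by
  simp only [factorizationSum]
  rw [sum_comm]
  refine sum_congr rfl fun π _ => ?_
  rw [sum_ite_eq]
  simp

theorem coloringCount_conj {ι : Type*} [DecidableEq ι] [Fintype ι] (w : ι → ℕ) (g π : Perm α) :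
    coloringCount w (g * π * g⁻¹) = coloringCount w π := by
  unfold coloringCount
  symm
  refine card_equiv (Equiv.arrowCongr g (Equiv.refl ι)) fun φ => ?_
  rw [mem_filter_univ, mem_filter_univ]
  change _ ↔ (∀ x, φ (g.symm (g (π (g.symm x)))) = φ (g.symm x)) ∧
    ∀ c, #{x | φ (g.symm x) = c} = w c
  simp only [symm_apply_apply]
  refine and_congr ⟨fun h x => h _, fun h x => ?_⟩ (forall_congr' fun c => ?_)
  · simpa using h (g x)
  · rw [card_equiv g fun x => ?_]
    simp

end Products

/-! ### The long cycle, and translation to colored factorizations -/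

theorem isFullCycleOn_finRotate (n : ℕ) : IsFullCycleOn (finRotate n) univ := by
  rw [isFullCycleOn_univ_iff]
  match n with
  | 0 => exact fun x => x.elim0
  | 1 => exact fun x y => Subsingleton.elim x y ▸ Perm.SameCycle.refl _ _
  | n + 2 =>
    intro x y
    have hs : ∀ x, finRotate (n + 2) x ≠ x := fun x => by
      rw [← Perm.mem_support, support_finRotate]; exact mem_univ x
    exact isCycle_finRotate.sameCycle (hs x) (hs y)

theorem IsFullCycleOn.isConj_finRotate {n : ℕ} {ζ : Perm (Fin n)} (h : IsFullCycleOn ζ univ) :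
    IsConj (finRotate n) ζ := by
  -- For `n ≤ 1` a full cycle is the identity, which is not an `IsCycle`.
  match n with
  | 0 => rw [Subsingleton.elim ζ]
  | 1 => rw [Subsingleton.elim ζ]
  | n + 2 =>
    have hne : ∀ x, ζ x ≠ x := fun x => by
      obtain ⟨y, hy⟩ := exists_ne x
      exact h.apply_ne (mem_univ x) (mem_univ y) hy
    have hc : ζ.IsCycle := ⟨0, hne 0, fun y _ => isFullCycleOn_univ_iff.1 h 0 y⟩
    refine isCycle_finRotate.isConj hc ?_
    rw [support_finRotate, eq_univ_of_forall fun x => Perm.mem_support.2 (hne x)]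

/-- Each sum over all full cycles is their number times the value at `finRotate n`, and this nonzero
number cancels. -/
theorem factorizationSum_finRotate_congr {n k : ℕ} {f f' : Fin k → Perm (Fin n) → ℕ}
    (hf : ∀ t g π, f t (g * π * g⁻¹) = f t π) (hf' : ∀ t g π, f' t (g * π * g⁻¹) = f' t π)
    (h : ∀ t σ, fullCycleSum (f t) σ = fullCycleSum (f' t) σ) :
    factorizationSum f (finRotate n) = factorizationSum f' (finRotate n) := by
  have hconst : ∀ F : Fin k → Perm (Fin n) → ℕ, (∀ t g π, F t (g * π * g⁻¹) = F t π) →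
      ∑ ζ : Perm (Fin n) with IsFullCycleOn ζ univ, factorizationSum F ζ =
        #{ζ : Perm (Fin n) | IsFullCycleOn ζ univ} * factorizationSum F (finRotate n) := by
    intro F hF
    rw [← smul_eq_mul, ← sum_const]
    refine sum_congr rfl fun ζ hζ => ?_
    obtain ⟨g, rfl⟩ := isConj_iff.1 (mem_filter.1 hζ).2.isConj_finRotate
    exact factorizationSum_conj hF g _
  have := sum_isFullCycleOn_prod_congr h 1
  simp only [one_mul] at this
  rw [sum_isFullCycleOn_prod_eq, sum_isFullCycleOn_prod_eq, hconst f hf, hconst f' hf'] at this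
  exact Nat.eq_of_mul_eq_mul_left
    (card_pos.2 ⟨finRotate n, mem_filter.2 ⟨mem_univ _, isFullCycleOn_finRotate n⟩⟩) this

/-- A colored factorization consists of a factorization and, for each factor, a coloring with the
prescribed color sizes that is constant on its cycles. -/
def coloredFactorizationEquiv {n k : ℕ} (γ : Fin k → Composition n) :
    {F : ColoredFactorization n k (fun t => (γ t).length) // F.HasColorCompositions γ} ≃
      Σ π : {π : Fin k → Perm (Fin n) // (List.ofFn π).prod = finRotate n}, ∀ t,
        {φ : Fin n → Fin (γ t).length //
          (∀ x, φ (π.1 t x) = φ x) ∧ ∀ c, #{x | φ x = c} = (γ t).blocksFun c} where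
  toFun F := ⟨⟨F.1.perm, F.1.prod_eq⟩, fun t => ⟨F.1.color t,
    fun x => F.1.color_eq_of_sameCycle t _ _ (Perm.sameCycle_apply_left.2 (Perm.SameCycle.refl _ _)),
    F.2 t⟩⟩
  invFun G :=
    ⟨{  perm := G.1.1
        color := fun t => (G.2 t).1
        prod_eq := G.1.2
        color_surjective := fun t i => by
          have hpos : 0 < #{x | (G.2 t).1 x = i} := by
            rw [(G.2 t).2.2 i]
            exact (γ t).one_le_blocksFun i
          obtain ⟨x, hx⟩ := card_pos.1 hpos
          exact ⟨x, (mem_filter.1 hx).2⟩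
        color_eq_of_sameCycle := fun t a b hab => by
          obtain ⟨m, -, rfl⟩ := hab.exists_pow_eq'
          induction m with
          | zero => rfl
          | succ m ih =>
            rw [pow_succ', Perm.mul_apply, (G.2 t).2.1]
            exact ih ⟨m, by simp⟩ },
      fun t => (G.2 t).2.2⟩
  left_inv _ := rfl
  right_inv _ := rfl

theorem numColoredFactorizations_eq_factorizationSum {n k : ℕ} (γ : Fin k → Composition n) :
    numColoredFactorizations γ =
      factorizationSum (fun t => coloringCount (γ t).blocksFun) (finRotate n) := by
  rw [numColoredFactorizations, Nat.card_congr (coloredFactorizationEquiv γ), Nat.card_sigma,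
    factorizationSum, ← sum_filter, ← sum_subtype_eq_sum_filter, subtype_univ]
  refine sum_congr rfl fun π _ => ?_
  rw [Nat.card_pi]
  refine prod_congr rfl fun t _ => ?_
  rw [Nat.card_eq_fintype_card, Fintype.card_subtype, coloringCount]
  congr!

/-- Compositions of equal length still give different color types; variables `p` and `q` allow the
equality to be substituted. -/
theorem fullCycleSum_coloringCount_fin_eq {α : Type*} [DecidableEq α] [Fintype α] {p q : ℕ}
    (hpq : p = q) {w : Fin p → ℕ} {w' : Fin q → ℕ} (hw : ∀ c, 0 < w c) (hw' : ∀ c, 0 < w' c)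
    (hsum : ∑ c, w c = ∑ c, w' c) (σ : Perm α) :
    fullCycleSum (coloringCount w) σ = fullCycleSum (coloringCount w') σ := by
  subst hpq
  exact fullCycleSum_coloringCount_eq hw hw' hsum σ

theorem theorem1p3 {n k : ℕ} (γ δ : Fin k → Composition n)
    (hlen : ∀ t : Fin k, (γ t).length = (δ t).length) :
    numColoredFactorizations γ = numColoredFactorizations δ := by
  rw [numColoredFactorizations_eq_factorizationSum, numColoredFactorizations_eq_factorizationSum]
  refine factorizationSum_finRotate_congr (fun t => coloringCount_conj _)
    (fun t => coloringCount_conj _) fun t σ => ?_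
  exact fullCycleSum_coloringCount_fin_eq (hlen t) (γ t).one_le_blocksFun (δ t).one_le_blocksFun
    ((γ t).sum_blocksFun.trans (δ t).sum_blocksFun.symm) σ
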